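/- Let $p$ be a prime, let $k$ be an uncountable algebraically closed field of characteristic $p$, and let $T$ be an integral scheme of finite type over $k$. Let $\overline{\eta}=\operatorname{Spec}\overline{k(T)}$ be the geometric generic point of $T$, where $\overline{k(T)}$ is an algebraic closure of the function field of $T$. A subset of $T$ is called c-open if its complement is a union of countably many closed subsets. Let $(f_i\colon X_i\to T)_{i\in I}$ be a countable collection of flat families over $T$, that is, of flat morphisms of finite type (for instance a single one). For a point $t\in T$ let $X_{i,t}=X_i\times_T\operatorname{Spec}\kappa(t)$ be the fiber, and let $X_{i,\overline{\eta}}=X_i\times_T\overline{\eta}$ be the geometric generic fiber. Then there is a c-open subset $U_0\subset T$ that contains the generic point of $T$ (i.e. $U_0$ is the complement of a countable union of proper closed subsets) such that for every closed point $t\in U_0$ there is an isomorphism $$e_t\colon \operatorname{Spec}\kappa(t)\xrightarrow{\ \sim\ }\overline{\eta}$$ of schemes over $\operatorname{Spec}\mathbb{F}_p$, and for every $i\in I$ there is an isomorphism $$\kappa_{i,t}\colon X_{i,t}\xrightarrow{\ \sim\ }X_{i,\overline{\eta}}$$ of schemes over $\operatorname{Spec}\mathbb{F}_p$ which is induced by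 $e_t$, in the sense that it forms a Cartesian square with $e_t$ and the projections $X_{i,t}\to\operatorname{Spec}\kappa(t)$ and $X_{i,\overline{\eta}}\to\overline{\eta}$. Moreover $\kappa_{i,t}$ preserves rational equivalence of algebraic cycles: two algebraic cycles $\alpha,\beta$ on $X_{i,t}$ are rationally equivalent if and only if their push-forwards $(\kappa_{i,t})_*\alpha$ and $(\kappa_{i,t})_*\beta$ are rationally equivalent on $X_{i,\overline{\eta}}$. -/

import Mathlib

open CategoryTheory CategoryTheory.Limits AlgebraicGeometry

universe u v

/-- A subset of a topological space is c-closed if it is a union of countably many closed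
subsets. -/
def IsCClosed {T : Type*} [TopologicalSpace T] (A : Set T) : Prop :=
  ∃ Z : ℕ → Set T, (∀ n, IsClosed (Z n)) ∧ A = ⋃ n, Z n

/-- A subset is c-open if its complement is c-closed. -/
def IsCOpen {T : Type*} [TopologicalSpace T] (U : Set T) : Prop :=
  IsCClosed Uᶜ

/-- The prime field `𝔽_p`, placed in the universe `u`. -/
abbrev PrimeFieldRing (p : ℕ) : CommRingCat.{u} := CommRingCat.of (ULift.{u} (ZMod p))

/-- The structure morphism `Spec k ⟶ Spec 𝔽_p` of a field of characteristic `p`. -/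
noncomputable def specToPrimeField (p : ℕ) (k : Type u) [Field k] [CharP k p] :
    Spec (CommRingCat.of k) ⟶ Spec (PrimeFieldRing.{u} p) :=
  Spec.map (CommRingCat.ofHom
    ((ZMod.castHom (dvd_refl p) k).comp (ULift.ringEquiv : ULift.{u} (ZMod p) ≃+* ZMod p)))

/-- The geometric generic point `η̄ = Spec \overline{k(T)}` of an integral scheme `T`. -/
noncomputable def geomGenericPoint (T : Scheme.{u}) [IsIntegral T] : Scheme.{u} :=
  Spec (CommRingCat.of (AlgebraicClosure T.functionField))

/-- The canonical morphism `η̄ ⟶ T`. -/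
noncomputable def fromGeomGenericPoint (T : Scheme.{u}) [IsIntegral T] :
    geomGenericPoint T ⟶ T :=
  Spec.map (CommRingCat.ofHom (algebraMap T.functionField (AlgebraicClosure T.functionField))) ≫
    T.fromSpecStalk (genericPoint T)

/-- The geometric generic fiber `X_η̄ = X ×_T η̄` of a morphism `f : X ⟶ T`. -/
noncomputable def geomGenericFiber {X T : Scheme.{u}} [IsIntegral T] (f : X ⟶ T) : Scheme.{u} :=
  pullback f (fromGeomGenericPoint T)

/-- The projection `X_η̄ ⟶ X`. -/
noncomputable def geomGenericFiberι {X T : Scheme.{u}} [IsIntegral T] (f : X ⟶ T) :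
    geomGenericFiber f ⟶ X :=
  pullback.fst f (fromGeomGenericPoint T)

/-- The projection `X_η̄ ⟶ η̄`. -/
noncomputable def geomGenericFiberToPoint {X T : Scheme.{u}} [IsIntegral T] (f : X ⟶ T) :
    geomGenericFiber f ⟶ geomGenericPoint T :=
  pullback.snd f (fromGeomGenericPoint T)

/-- `c` is the cycle `[div r]` on `Y` of a nonzero rational function `r` on the integral closed
subscheme `i : W ⟶ Y`: its coefficient at a point of `W` of codimension one is the order of
vanishing of `r` there, and all its other coefficients are zero. A point of `Y` stands for its
closure with the reduced structure; `Scheme.ord r w` is zero if `w` is not of codimension one. -/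
def IsDivOn {Y W : Scheme.{u}} (i : W ⟶ Y) [IsIntegral W] [IsLocallyNoetherian W]
    (r : W.functionField) (c : AlgebraicCycle Y ℤ) : Prop :=
  (∀ w : W, c (i w) = Scheme.ord r w) ∧ ∀ y : Y, y ∉ Set.range i → c y = 0

/-- The subgroup of cycles rationally equivalent to zero on `Y`, generated by the cycles `[div r]`
of nonzero rational functions `r` on integral closed subschemes `W` of `Y`. (On a scheme of finite
type over a field these generators are homogeneous with respect to dimension, so that this is the
direct sum of the corresponding subgroups of `d`-cycles.) -/
def ratTrivialCycles (Y : Scheme.{u}) : AddSubgroup (AlgebraicCycle Y ℤ) :=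
  AddSubgroup.closure {c | ∃ (W : Scheme.{u}) (i : W ⟶ Y) (_ : IsClosedImmersion i)
    (_ : IsIntegral W) (_ : IsLocallyNoetherian W) (r : W.functionField),
      r ≠ 0 ∧ IsDivOn i r c}

/-- Rational equivalence of algebraic cycles. -/
def RatEquiv {Y : Scheme.{u}} (α β : AlgebraicCycle Y ℤ) : Prop :=
  α - β ∈ ratTrivialCycles Y

/-- Push-forward of cycles along an isomorphism of schemes (with `Order.height`, the dimension of
the closure of a point, as weight). -/
noncomputable def cyclePushforward {Y Y' : Scheme.{u}} (κ : Y ≅ Y') (c : AlgebraicCycle Y ℤ) :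
    AlgebraicCycle Y' ℤ :=
  AlgebraicCycle.map κ.hom (fun y : Y => Order.height y) (fun y : Y' => Order.height y) c

/-! Only countably many functions on the base are needed to write the families down. On an affine
open `U` containing the generic point the families are of finite presentation, since `T` is locally
Noetherian, so each of them comes from a model over a countable ring of functions. Let `A` be the
countable subring of `Γ(U)` generated by the functions needed for all `i`, and let `U₀` be the part
of `U` where no nonzero element of `A` vanishes. For closed `t` in `U₀` both `A → κ(t)` and `A →
\overline{k(T)}` are injective. Both fields are algebraically closed of the uncountable cardinality
of `k`, so their transcendence bases over `A` are equipotent and there is an isomorphism of the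
fields over `A` (`IsAlgClosed.exists_ringEquiv_comp_eq`). The two fibers are base changes of the
same `A`-model, hence isomorphic over it.

The model itself is never constructed. `AgreeOnSections` plays the role of "equal after projection
to the model", and `exists_agreeOnSections_descent` says that a morphism to `Y` amounts to a class
for this relation together with a compatible morphism to the base. This is the universal property of
the base change, and it suffices to compare fibers (`exists_countable_isoOfIsPullback`).

The remaining claims are formal: morphisms to `Spec 𝔽_p` are unique, and an isomorphism of schemes
transports cycles and divisors of rational functions. -/

/-! ### Finitely presented algebras and countably many coefficients -/

theorem MvPolynomial.eval₂_eq_of_coeffs {A B R σ : Type*} [CommRing A] [CommRing B] [CommRing R]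
    (α : A →+* B) (ψ : B →+* R) (χ : A →+* R) (x : σ → B) (q : MvPolynomial σ A)
    (h : ∀ a ∈ q.coeffs, χ a = ψ (α a)) :
    q.eval₂ χ (fun i => ψ (x i)) = ψ (q.eval₂ α x) := by
  rw [MvPolynomial.eval₂_eq, MvPolynomial.eval₂_eq, map_sum]
  refine Finset.sum_congr rfl fun d hd => ?_
  rw [map_mul, map_prod, h _ (MvPolynomial.coeff_mem_coeffs d (MvPolynomial.mem_support_iff.1 hd))]
  simp

/-- A homomorphism out of a finitely presented algebra can be deformed to another one on the base
that agrees with it on suitable countably many elements, keeping the values on a given countable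
set of elements of the algebra. -/
theorem RingHom.FinitePresentation.exists_countable_lift {A B : Type u} [CommRing A] [CommRing B]
    {α : A →+* B} (hα : α.FinitePresentation) {F : Set B} (hF : F.Countable) :
    ∃ s : Set A, s.Countable ∧ ∀ (R : Type u) [CommRing R] (ψ : B →+* R) (χ : A →+* R),
      (∀ a ∈ s, χ a = ψ (α a)) → ∃ θ : B →+* R, θ.comp α = χ ∧ ∀ b ∈ F, θ b = ψ b := by
  algebraize [α]
  obtain ⟨n, f, hf, G, hG⟩ := Algebra.FinitePresentation.out (R := A) (A := B)
  have hf' : ∀ q, f q = q.eval₂ α (fun i => f (.X i)) := fun q => by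
    conv_lhs => rw [MvPolynomial.aeval_unique f]
    rfl
  choose h hh using hf
  -- Coefficients of the relations `G` make the new homomorphism well defined; those of the chosen
  -- polynomial lifts of `F` make it keep the values on `F`.
  refine ⟨⋃ q ∈ (G : Set (MvPolynomial (Fin n) A)) ∪ h '' F, (q.coeffs : Set A),
    ((G.countable_toSet.union (hF.image h)).biUnion fun q _ => q.coeffs.countable_toSet), ?_⟩
  intro R _ ψ χ H
  have key : ∀ q ∈ (G : Set (MvPolynomial (Fin n) A)) ∪ h '' F,
      MvPolynomial.eval₂Hom χ (fun i => ψ (f (.X i))) q = ψ (f q) := fun q hq => by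
    rw [hf' q]
    exact MvPolynomial.eval₂_eq_of_coeffs α ψ χ _ q fun a ha => H a (Set.mem_biUnion hq ha)
  have hker : RingHom.ker f.toRingHom ≤
      RingHom.ker (MvPolynomial.eval₂Hom χ (fun i => ψ (f (.X i)))) := by
    rw [← hG, Ideal.span_le]
    intro q hq
    have : f q = 0 := by
      have : q ∈ RingHom.ker f.toRingHom := hG ▸ Ideal.subset_span hq
      exact this
    rw [SetLike.mem_coe, RingHom.mem_ker, key q (.inl hq), this, map_zero]
  let θ := RingHom.liftOfRightInverse f.toRingHom h hh ⟨_, hker⟩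
  have hθ : ∀ q, θ (f q) = MvPolynomial.eval₂Hom χ (fun i => ψ (f (.X i))) q := fun q =>
    RingHom.liftOfRightInverse_comp_apply f.toRingHom h hh ⟨_, hker⟩ q
  refine ⟨θ, ?_, fun b hb => ?_⟩
  · ext a
    have : α a = f (.C a) := (f.commutes a).symm
    rw [RingHom.comp_apply, this, hθ]
    simp
  · have := hθ (h b)
    rwa [key _ (.inr ⟨b, hb, rfl⟩), hh] at this

/-- A finite set of algebra generators serves as `t`. This is the uniqueness that accompanies the
deformation above. -/
theorem RingHom.FinitePresentation.exists_countable_generators {A B : Type u} [CommRing A]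
    [CommRing B] {α : A →+* B} (hα : α.FinitePresentation) :
    ∃ t : Set B, t.Countable ∧ ∀ (R : Type u) [CommRing R] (θ θ' : B →+* R),
      θ.comp α = θ'.comp α → (∀ b ∈ t, θ b = θ' b) → θ = θ' := by
  algebraize [α]
  obtain ⟨t, ht⟩ := Algebra.FiniteType.out (R := A) (A := B)
  refine ⟨t, t.countable_toSet, fun R _ θ θ' h h' => ?_⟩
  ext b
  have hb : b ∈ Algebra.adjoin A (t : Set B) := ht ▸ Algebra.mem_top
  induction hb using Algebra.adjoin_induction with
  | mem x hx => exact h' x hx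
  | algebraMap r => exact congr($h r)
  | add x y _ _ hx hy => simp [hx, hy]
  | mul x y _ _ hx hy => simp [hx, hy]

/-! ### Morphisms into affine opens, gluing, agreement on sections -/

namespace AlgebraicGeometry

variable {Y Z : Scheme.{u}}

/-- The morphism from an open subscheme `O` of `Z` into an affine open `V` of `Y` given by a
homomorphism on sections. -/
noncomputable def IsAffineOpen.homOfSections {V : Y.Opens} (hV : IsAffineOpen V) {O : Z.Opens}
    (θ : Γ(Y, V) ⟶ Γ(Z, O)) : O.toScheme ⟶ Y :=
  O.toSpecΓ ≫ Spec.map θ ≫ hV.fromSpec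

namespace IsAffineOpen

variable {V : Y.Opens} (hV : IsAffineOpen V) {O : Z.Opens}

theorem homOfSections_appLE (ψ : Z ⟶ Y) (h : O ≤ ψ ⁻¹ᵁ V) :
    hV.homOfSections (ψ.appLE V O h) = O.ι ≫ ψ := by
  rw [homOfSections, Scheme.Opens.toSpecΓ_SpecMap_appLE_assoc, hV.toSpecΓ_fromSpec,
    Scheme.Hom.resLE_comp_ι]

theorem homOfLE_homOfSections {O' : Z.Opens} (h : O' ≤ O) (θ : Γ(Y, V) ⟶ Γ(Z, O)) :
    Z.homOfLE h ≫ hV.homOfSections θ =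
      hV.homOfSections (θ ≫ Z.presheaf.map (homOfLE h).op) := by
  rw [homOfSections, homOfSections, ← Scheme.Opens.toSpecΓ_SpecMap_presheaf_map_assoc,
    Spec.map_comp_assoc]

theorem homOfSections_map {V' : Y.Opens} (hV' : IsAffineOpen V') (h : V' ≤ V)
    (θ : Γ(Y, V') ⟶ Γ(Z, O)) :
    hV.homOfSections (Y.presheaf.map (homOfLE h).op ≫ θ) = hV'.homOfSections θ := by
  rw [homOfSections, homOfSections, Spec.map_comp_assoc, hV.map_fromSpec hV']

theorem homOfSections_injective :
    Function.Injective (hV.homOfSections : (Γ(Y, V) ⟶ Γ(Z, O)) → (O.toScheme ⟶ Y)) := by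
  intro θ θ' h
  rw [homOfSections, homOfSections, ← Category.assoc, ← Category.assoc, cancel_mono] at h
  have := congr(Scheme.Hom.appTop $h)
  rw [Scheme.Hom.comp_appTop, Scheme.Hom.comp_appTop, Scheme.Opens.toSpecΓ_appTop,
    Scheme.ΓSpecIso_naturality_assoc, Scheme.ΓSpecIso_naturality_assoc, cancel_epi,
    cancel_mono] at this
  exact this

theorem le_preimage_of_comp_eq {θ : Γ(Y, V) ⟶ Γ(Z, O)} {ψ : Z ⟶ Y}
    (h : O.ι ≫ ψ = hV.homOfSections θ) : O ≤ ψ ⁻¹ᵁ V := by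
  intro z hz
  obtain ⟨y, rfl⟩ : ∃ y : O.toScheme, O.ι y = z := ⟨⟨z, hz⟩, rfl⟩
  change ψ (O.ι y) ∈ V
  rw [← Scheme.Hom.comp_apply, h, homOfSections, ← Category.assoc, Scheme.Hom.comp_apply]
  exact hV.range_fromSpec.le ⟨_, rfl⟩

theorem appLE_eq_of_comp_eq {θ : Γ(Y, V) ⟶ Γ(Z, O)} {ψ : Z ⟶ Y}
    (h : O.ι ≫ ψ = hV.homOfSections θ) :
    ψ.appLE V O (hV.le_preimage_of_comp_eq h) = θ :=
  hV.homOfSections_injective (by rw [homOfSections_appLE, h])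

theorem homOfSections_comp {S : Scheme.{u}} [IsAffine S] (g : Y ⟶ S) (χ : Z ⟶ S)
    (θ : Γ(Y, V) ⟶ Γ(Z, O)) (e : V ≤ g ⁻¹ᵁ ⊤) (e' : O ≤ χ ⁻¹ᵁ ⊤)
    (h : g.appLE ⊤ V e ≫ θ = χ.appLE ⊤ O e') :
    hV.homOfSections θ ≫ g = O.ι ≫ χ := by
  rw [← (isAffineOpen_top S).homOfSections_appLE χ e', ← h]
  rw [homOfSections, homOfSections, Category.assoc, Category.assoc, Spec.map_comp_assoc,
    IsAffineOpen.SpecMap_appLE_fromSpec _ _ hV]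

include hV in
theorem hom_ext (ψ ψ' : Z ⟶ Y) (h : O ≤ ψ ⁻¹ᵁ V) (h' : O ≤ ψ' ⁻¹ᵁ V)
    (H : ψ.appLE V O h = ψ'.appLE V O h') : O.ι ≫ ψ = O.ι ≫ ψ' := by
  rw [← hV.homOfSections_appLE ψ h, H, homOfSections_appLE]

end IsAffineOpen

/-- Morphisms on the members of an open cover that agree locally on the overlaps glue. -/
theorem Scheme.exists_glue {ι : Type*} (O : ι → Z.Opens) (hO : ∀ z, ∃ i, z ∈ O i)
    (m : ∀ i, (O i).toScheme ⟶ Y)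
    (H : ∀ i j z, z ∈ O i → z ∈ O j → ∃ (O' : Z.Opens) (h : O' ≤ O i) (h' : O' ≤ O j),
      z ∈ O' ∧ Z.homOfLE h ≫ m i = Z.homOfLE h' ≫ m j) :
    ∃ f : Z ⟶ Y, ∀ i, (O i).ι ≫ f = m i := by
  have hO' : TopologicalSpace.IsOpenCover O := by
    refine top_le_iff.1 fun z _ => ?_
    obtain ⟨i, hi⟩ := hO z
    exact TopologicalSpace.Opens.mem_iSup.2 ⟨i, hi⟩
  have key : ∀ i j : ι, pullback.fst (O i).ι (O j).ι ≫ m i = pullback.snd _ _ ≫ m j := by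
    intro i j
    refine Scheme.hom_ext_of_forall _ _ fun x => ?_
    let a : pullback (O i).ι (O j).ι ⟶ (O i).toScheme := pullback.fst _ _
    let b : pullback (O i).ι (O j).ι ⟶ (O j).toScheme := pullback.snd _ _
    have hab : a ≫ (O i).ι = b ≫ (O j).ι := pullback.condition
    obtain ⟨O', h, h', hx, hO'⟩ := H i j ((a ≫ (O i).ι) x)
      (by rw [Scheme.Hom.comp_apply]; exact (a x).2)
      (by rw [hab, Scheme.Hom.comp_apply]; exact (b x).2)
    refine ⟨(a ≫ (O i).ι) ⁻¹ᵁ O', hx, ?_⟩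
    let r := (a ≫ (O i).ι).resLE O' _ le_rfl
    have h1 : ((a ≫ (O i).ι) ⁻¹ᵁ O').ι ≫ a = r ≫ Z.homOfLE h := by
      rw [← cancel_mono (O i).ι, Category.assoc, Category.assoc, Scheme.homOfLE_ι,
        Scheme.Hom.resLE_comp_ι]
    have h2 : ((a ≫ (O i).ι) ⁻¹ᵁ O').ι ≫ b = r ≫ Z.homOfLE h' := by
      rw [← cancel_mono (O j).ι, Category.assoc, Category.assoc, Scheme.homOfLE_ι,
        Scheme.Hom.resLE_comp_ι, hab]
    change _ ≫ a ≫ m i = _ ≫ b ≫ m j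
    rw [reassoc_of% h1, reassoc_of% h2, hO']
  exact ⟨(Z.openCoverOfIsOpenCover O hO').glueMorphisms m key,
    fun i => (Z.openCoverOfIsOpenCover O hO').ι_glueMorphisms m key i⟩

/-- Two morphisms to `Y` agree on a family of sections `F i` over opens `W i` if they have the same
preimages of the `W i` and pull back the sections in `F i` to the same sections. -/
def AgreeOnSections {I : Type u} (W : I → Y.Opens) (F : ∀ i, Set Γ(Y, W i)) (ψ θ : Z ⟶ Y) : Prop :=
  ∀ i, ψ ⁻¹ᵁ W i = θ ⁻¹ᵁ W i ∧ ∀ (O : Z.Opens) (h : O ≤ ψ ⁻¹ᵁ W i) (h' : O ≤ θ ⁻¹ᵁ W i),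
    ∀ b ∈ F i, ψ.appLE (W i) O h b = θ.appLE (W i) O h' b

namespace AgreeOnSections

variable {I : Type u} {W : I → Y.Opens} {F : ∀ i, Set Γ(Y, W i)} {ψ θ ζ : Z ⟶ Y}

theorem symm (H : AgreeOnSections W F ψ θ) : AgreeOnSections W F θ ψ :=
  fun i => ⟨(H i).1.symm, fun O h h' b hb => ((H i).2 O h' h b hb).symm⟩

theorem trans (H : AgreeOnSections W F ψ θ) (H' : AgreeOnSections W F θ ζ) :
    AgreeOnSections W F ψ ζ :=
  fun i => ⟨(H i).1.trans (H' i).1, fun O h h' b hb =>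
    ((H i).2 O h ((H i).1 ▸ h) b hb).trans ((H' i).2 O ((H i).1 ▸ h) h' b hb)⟩

theorem precomp {Z' : Scheme.{u}} (z : Z' ⟶ Z) (H : AgreeOnSections W F ψ θ) :
    AgreeOnSections W F (z ≫ ψ) (z ≫ θ) := by
  intro i
  refine ⟨congr(z ⁻¹ᵁ $((H i).1)), fun O h h' b hb => ?_⟩
  have key := (H i).2 (ψ ⁻¹ᵁ W i) le_rfl (H i).1.le b hb
  have h1 := Scheme.Hom.appLE_comp_appLE z ψ (W i) (ψ ⁻¹ᵁ W i) O le_rfl h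
  have h2 := Scheme.Hom.appLE_comp_appLE z θ (W i) (ψ ⁻¹ᵁ W i) O (H i).1.le h
  rw [← h1, ← h2, CommRingCat.comp_apply, CommRingCat.comp_apply, key]

end AgreeOnSections

end AlgebraicGeometry

/-! ### Descent to countably many functions through the functor of points -/

namespace AlgebraicGeometry

theorem Scheme.exists_finite_affineOpens_cover (Y : Scheme.{u}) [CompactSpace Y] :
    ∃ (I : Type u) (_ : Finite I) (W : I → Y.Opens), (∀ i, IsAffineOpen (W i)) ∧
      ∀ y, ∃ i, y ∈ W i := by
  have h : ∀ y : Y, ∃ W : Y.Opens, IsAffineOpen W ∧ y ∈ W := fun y => by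
    obtain ⟨W, hW, hy, -⟩ := exists_isAffineOpen_mem_and_subset (x := y) (U := ⊤) trivial
    exact ⟨W, hW, hy⟩
  choose W hW hy using h
  obtain ⟨t, ht⟩ := CompactSpace.elim_nhds_subcover (fun y => (W y : Set Y))
    fun y => (W y).2.mem_nhds (hy y)
  refine ⟨t, inferInstance, fun i => W i, fun i => hW i, fun y => ?_⟩
  have : y ∈ ⋃ x ∈ t, (W x : Set Y) := ht ▸ trivial
  obtain ⟨x, hx, hyx⟩ := Set.mem_iUnion₂.1 this
  exact ⟨⟨x, hx⟩, hyx⟩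

/-- Each member is basic in both charts, so a section over either chart detects whether a point lies
in it. -/
theorem IsAffineOpen.exists_finite_basicOpen_cover_inter {Y : Scheme.{u}} [QuasiSeparatedSpace Y]
    {W W' : Y.Opens} (hW : IsAffineOpen W) (hW' : IsAffineOpen W') :
    ∃ C : Set (Γ(Y, W) × Γ(Y, W')), C.Finite ∧ (∀ c ∈ C, Y.basicOpen c.1 = Y.basicOpen c.2) ∧
      ∀ y ∈ W, y ∈ W' → ∃ c ∈ C, y ∈ Y.basicOpen c.1 := by
  have hK : IsCompact ((W : Set Y) ∩ W') :=
    QuasiSeparatedSpace.inter_isCompact _ _ W.2 hW.isCompact W'.2 hW'.isCompact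
  have h : ∀ y : ((W : Set Y) ∩ W' : Set Y), ∃ c : Γ(Y, W) × Γ(Y, W'),
      Y.basicOpen c.1 = Y.basicOpen c.2 ∧ y.1 ∈ Y.basicOpen c.1 := fun y => by
    obtain ⟨f, g, h, h'⟩ := exists_basicOpen_le_affine_inter hW hW' y.1 y.2
    exact ⟨⟨f, g⟩, h, h'⟩
  choose c hc hy using h
  obtain ⟨t, ht⟩ := hK.elim_finite_subcover (fun y => (Y.basicOpen (c y).1 : Set Y))
    (fun y => (Y.basicOpen (c y).1).2) fun y hy' => Set.mem_iUnion.2 ⟨⟨y, hy'⟩, hy ⟨y, hy'⟩⟩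
  refine ⟨c '' t, t.finite_toSet.image c, ?_, fun y h h' => ?_⟩
  · rintro _ ⟨y, -, rfl⟩
    exact hc y
  · obtain ⟨x, hx, hyx⟩ := Set.mem_iUnion₂.1 (ht ⟨h, h'⟩)
    exact ⟨_, ⟨x, hx, rfl⟩, hyx⟩

/-- A scheme `Y` of finite presentation over an affine scheme `S` is, in terms of its functor of
points, the base change of a scheme over a countable ring of functions on `S`:
the relation `AgreeOnSections W F` plays the role of equality after projection to that scheme. -/
theorem exists_agreeOnSections_descent {Y S : Scheme.{u}} [IsAffine S] (g : Y ⟶ S)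
    [LocallyOfFinitePresentation g] [CompactSpace Y] [QuasiSeparatedSpace Y] :
    ∃ (I : Type u) (W : I → Y.Opens) (F : ∀ i, Set Γ(Y, W i)) (s : Set Γ(S, ⊤)), s.Countable ∧
      (∀ (Z : Scheme.{u}) (ψ : Z ⟶ Y) (χ : Z ⟶ S),
        (∀ a ∈ s, χ.appTop a = (ψ ≫ g).appTop a) →
        ∃ θ : Z ⟶ Y, AgreeOnSections W F ψ θ ∧ θ ≫ g = χ) ∧
      ∀ (Z : Scheme.{u}) (ψ θ : Z ⟶ Y), AgreeOnSections W F ψ θ → ψ ≫ g = θ ≫ g → ψ = θ := by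
  obtain ⟨I, _, W, hW, hcov⟩ := Y.exists_finite_affineOpens_cover
  choose C hCfin hC hCcov using fun i j =>
    (hW i).exists_finite_basicOpen_cover_inter (hW j)
  have htop (V : Y.Opens) : V ≤ g ⁻¹ᵁ ⊤ := le_top
  have hfp (V : Y.Opens) (hV : IsAffineOpen V) : (g.appLE ⊤ V (htop V)).hom.FinitePresentation :=
    g.finitePresentation_appLE (isAffineOpen_top S) hV _
  choose t ht htgen using fun i => (hfp (W i) (hW i)).exists_countable_generators
  -- Generators give uniqueness of morphisms; the sections cutting out the overlaps control the
  -- preimages of the charts.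
  let F : ∀ i, Set Γ(Y, W i) := fun i =>
    t i ∪ ((⋃ j, Prod.fst '' C i j) ∪ ⋃ j, Prod.snd '' C j i)
  have hF (i) : (F i).Countable := (ht i).union
    ((Set.countable_iUnion fun j => ((hCfin i j).image _).countable).union
      (Set.countable_iUnion fun j => ((hCfin j i).image _).countable))
  choose s hs hlift using fun i => (hfp (W i) (hW i)).exists_countable_lift (hF i)
  have hV (i j) (c : C i j) : IsAffineOpen (Y.basicOpen c.1.1) := (hW i).basicOpen _
  have hVi (i j) (c : C i j) : Y.basicOpen c.1.1 ≤ W i := Y.basicOpen_le _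
  have hVj (i j) (c : C i j) : Y.basicOpen c.1.1 ≤ W j := (hC i j _ c.2).le.trans (Y.basicOpen_le _)
  -- On an overlap the values coming from both charts are kept, so that one deformation there can be
  -- compared with those on either chart.
  let F' (i j) (c : C i j) : Set Γ(Y, Y.basicOpen c.1.1) :=
    Y.presheaf.map (homOfLE (hVi i j c)).op '' F i ∪ Y.presheaf.map (homOfLE (hVj i j c)).op '' F j
  have hF' (i j) (c : C i j) : (F' i j c).Countable := ((hF i).image _).union ((hF j).image _)
  choose s' hs' hlift' using fun i j (c : C i j) =>
    (hfp _ (hV i j c)).exists_countable_lift (hF' i j c)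
  have hCc (i j) : Countable (C i j) := (hCfin i j).countable.to_subtype
  refine ⟨I, W, F, (⋃ i, s i) ∪ ⋃ i, ⋃ j, ⋃ c, s' i j c, ?_, ?_, ?_⟩
  · exact (Set.countable_iUnion hs).union (Set.countable_iUnion fun i =>
      Set.countable_iUnion fun j => Set.countable_iUnion fun c => hs' i j c)
  · intro Z ψ χ H
    have htop' (O : Z.Opens) : O ≤ χ ⁻¹ᵁ ⊤ := le_top
    have key (V : Y.Opens) (O : Z.Opens) (h : O ≤ ψ ⁻¹ᵁ V) (a)
        (ha : a ∈ (⋃ i, s i) ∪ ⋃ i, ⋃ j, ⋃ c, s' i j c) :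
        (χ.appLE ⊤ O (htop' O)).hom a = (ψ.appLE V O h).hom ((g.appLE ⊤ V (htop V)).hom a) := by
      have h1 := H a ha
      have h2 := Scheme.Hom.appLE_comp_appLE ψ g ⊤ V O (htop V) h
      change _ = (g.appLE ⊤ V (htop V) ≫ ψ.appLE V O h).hom a
      rw [h2]
      exact congr(Z.presheaf.map (homOfLE (le_top : O ≤ ⊤)).op $h1)
    have hex (i) : ∃ θ : Γ(Y, W i) ⟶ Γ(Z, ψ ⁻¹ᵁ W i),
        g.appLE ⊤ (W i) (htop _) ≫ θ = χ.appLE ⊤ _ (htop' _) ∧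
          ∀ b ∈ F i, θ b = ψ.appLE (W i) _ le_rfl b := by
      obtain ⟨θ, h1, h2⟩ := hlift i Γ(Z, ψ ⁻¹ᵁ W i) (ψ.appLE (W i) _ le_rfl).hom
        (χ.appLE ⊤ _ (htop' _)).hom fun a ha => key _ _ _ a (.inl (Set.mem_iUnion.2 ⟨i, ha⟩))
      exact ⟨CommRingCat.ofHom θ, CommRingCat.hom_ext h1, h2⟩
    choose θ hθg hθF using hex
    have hex' (i j) (c : C i j) : ∃ θ' : Γ(Y, Y.basicOpen c.1.1) ⟶ Γ(Z, ψ ⁻¹ᵁ Y.basicOpen c.1.1),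
        g.appLE ⊤ _ (htop _) ≫ θ' = χ.appLE ⊤ _ (htop' _) ∧
          ∀ b ∈ F' i j c, θ' b = ψ.appLE _ _ le_rfl b := by
      obtain ⟨θ, h1, h2⟩ := hlift' i j c Γ(Z, ψ ⁻¹ᵁ Y.basicOpen c.1.1) (ψ.appLE _ _ le_rfl).hom
        (χ.appLE ⊤ _ (htop' _)).hom fun a ha => key _ _ _ a (.inr (Set.mem_iUnion.2 ⟨i,
          Set.mem_iUnion.2 ⟨j, Set.mem_iUnion.2 ⟨c, ha⟩⟩⟩))
      exact ⟨CommRingCat.ofHom θ, CommRingCat.hom_ext h1, h2⟩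
    choose θ' hθg' hθF' using hex'
    -- The chart deformation restricts to the overlap deformation: both lie over `χ` and take the
    -- values of `ψ` on the generators of the chart. Hence any two chart deformations agree on the
    -- overlap.
    have hres (i : I) (V : Y.Opens) (hVW : V ≤ W i) (θ' : Γ(Y, V) ⟶ Γ(Z, ψ ⁻¹ᵁ V))
        (h1 : g.appLE ⊤ _ (htop _) ≫ θ' = χ.appLE ⊤ _ (htop' _))
        (h2 : ∀ b ∈ F i, θ' (Y.presheaf.map (homOfLE hVW).op b) =
          ψ.appLE _ _ le_rfl (Y.presheaf.map (homOfLE hVW).op b)) (h : ψ ⁻¹ᵁ V ≤ ψ ⁻¹ᵁ W i) :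
        θ i ≫ Z.presheaf.map (homOfLE h).op = Y.presheaf.map (homOfLE hVW).op ≫ θ' := by
      refine CommRingCat.hom_ext (htgen i _ _ _ ?_ fun b hb => ?_)
      · rw [← CommRingCat.hom_comp, ← CommRingCat.hom_comp, reassoc_of% hθg i,
          Scheme.Hom.appLE_map_assoc, h1, Scheme.Hom.appLE_map]
      · have hb' : b ∈ F i := .inl hb
        have h3 := congr(Z.presheaf.map (homOfLE h).op $(hθF i b hb'))
        rw [← CommRingCat.comp_apply, ← CommRingCat.comp_apply, Scheme.Hom.appLE_map] at h3
        have h4 := h2 b hb'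
        rw [← CommRingCat.comp_apply, ← CommRingCat.comp_apply, Scheme.Hom.map_appLE] at h4
        exact h3.trans h4.symm
    obtain ⟨f, hf⟩ := Scheme.exists_glue (fun i => ψ ⁻¹ᵁ W i) (fun z => hcov (ψ z))
      (fun i => (hW i).homOfSections (θ i)) fun i j z hi hj => by
        obtain ⟨c, hc, hz⟩ := hCcov i j (ψ z) hi hj
        have hle {V V' : Y.Opens} (h : V ≤ V') : ψ ⁻¹ᵁ V ≤ ψ ⁻¹ᵁ V' := fun z hz => h hz
        refine ⟨ψ ⁻¹ᵁ Y.basicOpen c.1, hle (hVi i j ⟨c, hc⟩), hle (hVj i j ⟨c, hc⟩), hz, ?_⟩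
        rw [IsAffineOpen.homOfLE_homOfSections, IsAffineOpen.homOfLE_homOfSections,
          hres i _ (hVi i j ⟨c, hc⟩) (θ' i j ⟨c, hc⟩) (hθg' i j ⟨c, hc⟩)
            fun b hb => hθF' i j ⟨c, hc⟩ _ (.inl ⟨b, hb, rfl⟩),
          hres j _ (hVj i j ⟨c, hc⟩) (θ' i j ⟨c, hc⟩) (hθg' i j ⟨c, hc⟩)
            fun b hb => hθF' i j ⟨c, hc⟩ _ (.inr ⟨b, hb, rfl⟩),
          (hW i).homOfSections_map (hV i j ⟨c, hc⟩), (hW j).homOfSections_map (hV i j ⟨c, hc⟩)]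
    have hle (i) : ψ ⁻¹ᵁ W i ≤ f ⁻¹ᵁ W i := (hW i).le_preimage_of_comp_eq (hf i)
    have happ (i) : f.appLE (W i) (ψ ⁻¹ᵁ W i) (hle i) = θ i := (hW i).appLE_eq_of_comp_eq (hf i)
    refine ⟨f, fun i => ⟨le_antisymm (hle i) fun z hz => ?_, fun O h h' b hb => ?_⟩, ?_⟩
    -- If `f z` is in `W i` and `ψ z` in `W j`, then `f z` lies in some overlap piece, cut out by a
    -- section in `F j`. As `f` and `ψ` pull that section back equally, `ψ z` lies in the same
    -- piece, hence in `W i`.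
    · obtain ⟨j, hj⟩ := hcov (ψ z)
      obtain ⟨c, hc, hzc⟩ := hCcov i j (f z) hz (hle j hj)
      rw [hC i j c hc] at hzc
      have h1 := Scheme.basicOpen_appLE f _ _ (hle j) c.2
      have h2 := Scheme.basicOpen_appLE ψ _ _ (le_refl (ψ ⁻¹ᵁ W j)) c.2
      rw [happ, hθF j _ (.inr (.inr (Set.mem_iUnion.2 ⟨i, c, hc, rfl⟩))), h2] at h1
      have h3 : z ∈ ψ ⁻¹ᵁ W j ⊓ ψ ⁻¹ᵁ Y.basicOpen c.2 := h1 ▸ ⟨hj, hzc⟩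
      have h4 : ψ z ∈ Y.basicOpen c.2 := h3.2
      rw [← hC i j c hc] at h4
      exact Y.basicOpen_le _ h4
    · have h1 := congr(Z.presheaf.map (homOfLE h).op $(hθF i b hb))
      rw [← happ i, ← CommRingCat.comp_apply, ← CommRingCat.comp_apply, Scheme.Hom.appLE_map,
        Scheme.Hom.appLE_map] at h1
      exact h1.symm
    · refine Scheme.hom_ext_of_forall _ _ fun z => ?_
      obtain ⟨i, hi⟩ := hcov (ψ z)
      refine ⟨ψ ⁻¹ᵁ W i, hi, ?_⟩
      rw [reassoc_of% hf i, (hW i).homOfSections_comp g χ _ _ _ (hθg i)]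
  · intro Z ψ ζ H hg
    refine Scheme.hom_ext_of_forall _ _ fun z => ?_
    obtain ⟨i, hi⟩ := hcov (ψ z)
    refine ⟨ψ ⁻¹ᵁ W i, hi, (hW i).hom_ext ψ ζ le_rfl (H i).1.le ?_⟩
    refine CommRingCat.hom_ext (htgen i _ _ _ ?_ fun b hb => (H i).2 _ _ _ b (.inl hb))
    rw [← CommRingCat.hom_comp, ← CommRingCat.hom_comp, Scheme.Hom.appLE_comp_appLE,
      Scheme.Hom.appLE_comp_appLE]
    simp only [hg]

end AlgebraicGeometry

/-! ### Base changes along points that agree on countably many functions -/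

namespace AlgebraicGeometry

/-- Deforming `a` to lie over `x'` gives a morphism `P ⟶ P'`, and symmetrically back. The composites
are identities because their projections to `Y` agree on sections with the original ones and lie
over the same morphism to `S`. -/
theorem exists_iso_of_agreeOnSections_descent {Y S : Scheme.{u}} {g : Y ⟶ S} {I : Type u}
    {W : I → Y.Opens} {F : ∀ i, Set Γ(Y, W i)} {s : Set Γ(S, ⊤)}
    (hex : ∀ (Z : Scheme.{u}) (ψ : Z ⟶ Y) (χ : Z ⟶ S),
      (∀ a ∈ s, χ.appTop a = (ψ ≫ g).appTop a) →
        ∃ θ : Z ⟶ Y, AgreeOnSections W F ψ θ ∧ θ ≫ g = χ)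
    (huniq : ∀ (Z : Scheme.{u}) (ψ θ : Z ⟶ Y),
      AgreeOnSections W F ψ θ → ψ ≫ g = θ ≫ g → ψ = θ)
    {P P' K : Scheme.{u}} {x x' : K ⟶ S} {a : P ⟶ Y} {b : P ⟶ K} {a' : P' ⟶ Y} {b' : P' ⟶ K}
    (hP : IsPullback a b g x) (hP' : IsPullback a' b' g x')
    (hx : ∀ r ∈ s, x.appTop r = x'.appTop r) : ∃ m : P ≅ P', m.hom ≫ b' = b := by
  have aux {P : Scheme.{u}} {a : P ⟶ Y} {b : P ⟶ K} {x x' : K ⟶ S} (h : a ≫ g = b ≫ x)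
      (hx : ∀ r ∈ s, x.appTop r = x'.appTop r) :
      ∃ θ : P ⟶ Y, AgreeOnSections W F a θ ∧ θ ≫ g = b ≫ x' := by
    refine hex P a (b ≫ x') fun r hr => ?_
    rw [h, Scheme.Hom.comp_appTop, Scheme.Hom.comp_appTop, CommRingCat.comp_apply,
      CommRingCat.comp_apply, hx r hr]
  obtain ⟨θ, hθ, hθg⟩ := aux hP.w hx
  obtain ⟨θ', hθ', hθg'⟩ := aux hP'.w fun r hr => (hx r hr).symm
  have inv {P P' : Scheme.{u}} {x x' : K ⟶ S} {a : P ⟶ Y} {b : P ⟶ K} {a' : P' ⟶ Y} {b' : P' ⟶ K}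
      (hP : IsPullback a b g x) (hP' : IsPullback a' b' g x') {θ : P ⟶ Y} {θ' : P' ⟶ Y}
      (hθ : AgreeOnSections W F a θ) (hθg : θ ≫ g = b ≫ x')
      (hθ' : AgreeOnSections W F a' θ') (hθg' : θ' ≫ g = b' ≫ x) :
      hP'.lift θ b hθg ≫ hP.lift θ' b' hθg' = 𝟙 P := by
    refine hP.hom_ext (huniq _ _ _ ?_ ?_) (by simp)
    · have h1 := hθ'.precomp (hP'.lift θ b hθg)
      rw [hP'.lift_fst] at h1
      rw [Category.id_comp, Category.assoc, hP.lift_fst]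
      exact (hθ.trans h1).symm
    · simp [hθg', hP.w]
  exact ⟨⟨hP'.lift θ b hθg, hP.lift θ' b' hθg', inv hP hP' hθ hθg hθ' hθg',
    inv hP' hP hθ' hθg' hθ hθg⟩, hP'.lift_snd _ _ _⟩

/-- Base changes of a scheme of finite presentation over an affine scheme `S` along two morphisms
to `S` that agree on suitable countably many functions are isomorphic. -/
theorem exists_countable_isoOfIsPullback {Y S : Scheme.{u}} [IsAffine S] (g : Y ⟶ S)
    [LocallyOfFinitePresentation g] [CompactSpace Y] [QuasiSeparatedSpace Y] :
    ∃ s : Set Γ(S, ⊤), s.Countable ∧ ∀ (P P' K : Scheme.{u}) (x x' : K ⟶ S) (a : P ⟶ Y)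
      (b : P ⟶ K) (a' : P' ⟶ Y) (b' : P' ⟶ K), IsPullback a b g x → IsPullback a' b' g x' →
      (∀ r ∈ s, x.appTop r = x'.appTop r) → ∃ m : P ≅ P', m.hom ≫ b' = b := by
  obtain ⟨I, W, F, s, hs, hex, huniq⟩ := exists_agreeOnSections_descent g
  exact ⟨s, hs, fun P P' K x x' a b a' b' hP hP' hx =>
    exists_iso_of_agreeOnSections_descent hex huniq hP hP' hx⟩

theorem appTop_ne_zero_of_mem_basicOpen {K : Type u} [Field K] {S : Scheme.{u}}
    (x : Spec (CommRingCat.of K) ⟶ S) (a : Γ(S, ⊤)) (y : Spec (CommRingCat.of K))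
    (h : x y ∈ S.basicOpen a) : x.appTop a ≠ 0 := by
  intro h0
  have h1 : y ∈ x ⁻¹ᵁ S.basicOpen a := h
  rw [Scheme.preimage_basicOpen] at h1
  change y ∈ (Spec (CommRingCat.of K)).basicOpen (x.appTop a) at h1
  rw [h0, Scheme.basicOpen_zero] at h1
  exact h1

end AlgebraicGeometry

/-! ### Isomorphisms of uncountable algebraically closed fields -/

open Cardinal in
-- Over a countable ring, a transcendence basis of an uncountable algebraically closed field has the
-- cardinality of the field.
theorem IsAlgClosed.exists_ringEquiv_comp_eq {A K L : Type u} [CommRing A] [Countable A] [Field K]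
    [Field L] [IsAlgClosed K] [IsAlgClosed L] (hK : ℵ₀ < #K) (hKL : #K = #L) (φ : A →+* K)
    (φ' : A →+* L) (hφ : Function.Injective φ) (hφ' : Function.Injective φ') :
    ∃ e : K ≃+* L, ∀ a, e (φ a) = φ' a := by
  algebraize [φ, φ']
  have : IsDomain A := hφ.isDomain φ
  have : Module.IsTorsionFree A K := Module.isTorsionFree_iff_algebraMap_injective.2 hφ
  have : Module.IsTorsionFree A L := Module.isTorsionFree_iff_algebraMap_injective.2 hφ'
  have : FaithfulSMul A K := (faithfulSMul_iff_algebraMap_injective A K).2 hφ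
  have : FaithfulSMul A L := (faithfulSMul_iff_algebraMap_injective A L).2 hφ'
  obtain ⟨s, hs⟩ := exists_isTranscendenceBasis A K
  obtain ⟨t, ht⟩ := exists_isTranscendenceBasis A L
  have hA : #A ≤ ℵ₀ := mk_le_aleph0
  have h1 := IsAlgClosed.cardinal_eq_cardinal_transcendence_basis_of_aleph0_lt' _ hs hA hK
  have h2 := IsAlgClosed.cardinal_eq_cardinal_transcendence_basis_of_aleph0_lt' _ ht hA (hKL ▸ hK)
  obtain ⟨e⟩ := Cardinal.eq.1 (h1.symm.trans (hKL.trans h2))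
  have := IsAlgClosed.isAlgClosure_of_transcendence_basis _ hs
  have := IsAlgClosed.isAlgClosure_of_transcendence_basis _ ht
  -- A bijection of the bases identifies two polynomial rings over `A`, of which `K` and `L` are
  -- algebraic closures; the identification extends to them.
  let e₀ : Algebra.adjoin A (Set.range ((↑) : s → K)) ≃ₐ[A]
      Algebra.adjoin A (Set.range ((↑) : t → L)) :=
    (hs.1.aevalEquiv.symm.trans (MvPolynomial.renameEquiv A e)).trans ht.1.aevalEquiv
  refine ⟨IsAlgClosure.equivOfEquiv K L e₀.toRingEquiv, fun a => ?_⟩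
  have h3 := IsAlgClosure.equivOfEquiv_algebraMap K L e₀.toRingEquiv (algebraMap A _ a)
  rw [← IsScalarTower.algebraMap_apply] at h3
  refine h3.trans ?_
  have h4 : e₀.toRingEquiv (algebraMap A _ a) = algebraMap A _ a := e₀.commutes a
  rw [h4, ← IsScalarTower.algebraMap_apply]
  rfl

/-! ### Cardinality of the geometric generic point; countable subrings -/

namespace AlgebraicGeometry

open Cardinal

/-- An affine chart has a coordinate ring that is a quotient of a polynomial ring in finitely many
variables over `k`; passing to fractions and to the algebraic closure does not enlarge an infinite
cardinal bound. -/
theorem Scheme.cardinalMk_geomGenericPoint_le {k : Type u} [Field k] [Infinite k] {T : Scheme.{u}}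
    [IsIntegral T] (s : T ⟶ Spec (CommRingCat.of k)) [LocallyOfFiniteType s] :
    #(AlgebraicClosure T.functionField) ≤ #k := by
  obtain ⟨U, hU, hη, -⟩ := exists_isAffineOpen_mem_and_subset (x := genericPoint T) (U := ⊤) trivial
  have : Nonempty U := ⟨⟨_, hη⟩⟩
  have hk : ℵ₀ ≤ #k := aleph0_le_mk k
  have hft := s.finiteType_appLE (isAffineOpen_top _) hU (le_top : U ≤ s ⁻¹ᵁ ⊤)
  have hU' : #Γ(T, U) ≤ #k := by
    algebraize [(s.appLE ⊤ U (le_top : U ≤ s ⁻¹ᵁ ⊤)).hom]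
    obtain ⟨n, f, hf⟩ := Algebra.FiniteType.iff_quotient_mvPolynomial''.1
      (inferInstance : Algebra.FiniteType Γ(Spec (CommRingCat.of k), ⊤) Γ(T, U))
    have h1 : #Γ(Spec (CommRingCat.of k), ⊤) = #k :=
      mk_congr (Scheme.ΓSpecIso (CommRingCat.of k)).commRingCatIsoToRingEquiv.toEquiv
    refine (mk_le_of_surjective hf).trans ?_
    have := MvPolynomial.cardinalMk_le_max_lift (σ := Fin n) (R := Γ(Spec (CommRingCat.of k), ⊤))
    refine this.trans ?_
    simp [h1, hk, (natCast_lt_aleph0 (n := n)).le.trans hk]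
  have := functionField_isFractionRing_of_isAffineOpen T U hU
  refine (Algebra.IsAlgebraic.cardinalMk_le_max T.functionField _).trans ?_
  rw [IsFractionRing.cardinalMk Γ(T, U) T.functionField]
  exact max_le hU' hk

theorem Scheme.cardinalMk_geomGenericPoint {k : Type u} [Field k] [Infinite k] {T : Scheme.{u}}
    [IsIntegral T] (s : T ⟶ Spec (CommRingCat.of k)) [LocallyOfFiniteType s] :
    #(AlgebraicClosure T.functionField) = #k := by
  refine le_antisymm (Scheme.cardinalMk_geomGenericPoint_le s) ?_
  -- The structure morphism embeds `k` into the field.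
  let φ := (Spec.preimage (fromGeomGenericPoint T ≫ s)).hom
  exact mk_le_of_injective φ.injective

end AlgebraicGeometry

theorem Set.Countable.subringClosure {A : Type*} [CommRing A] {s : Set A} (hs : s.Countable) :
    (Subring.closure s : Set A).Countable := by
  have := hs.to_subtype
  have : Countable (MvPolynomial s ℤ) := by
    rw [← Cardinal.mk_le_aleph0_iff]
    exact MvPolynomial.cardinalMk_le_max_lift.trans (by simp)
  refine (Set.countable_range (MvPolynomial.aeval (R := ℤ) ((↑) : s → A))).mono ?_
  have : Subring.closure s ≤ (MvPolynomial.aeval (R := ℤ) ((↑) : s → A)).toRingHom.range := by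
    rw [Subring.closure_le]
    exact fun x hx => ⟨.X ⟨x, hx⟩, by simp⟩
  exact this

/-! ### Cycles and rational equivalence under isomorphisms -/

namespace AlgebraicGeometry

variable {Y Y' : Scheme.{u}}

theorem Scheme.Hom.residueDegree_eq_one_of_isIso (f : Y ⟶ Y') [IsIso f] (y : Y) :
    f.residueDegree y = 1 := by
  let := (f.residueFieldMap y).hom.toAlgebra
  let e : Y'.residueField (f y) ≃ₗ[Y'.residueField (f y)] Y.residueField y :=
    { (asIso (f.residueFieldMap y)).commRingCatIsoToRingEquiv with
      map_smul' := fun r x => by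
        change (f.residueFieldMap y).hom (r * x) = (f.residueFieldMap y).hom r * _
        rw [map_mul]
        rfl }
  change Module.finrank (Y'.residueField (f y)) (Y.residueField y) = 1
  rw [← e.finrank_eq, Module.finrank_self]

theorem Scheme.height_apply_of_iso (κ : Y ≅ Y') (y : Y) :
    Order.height (κ.hom y) = Order.height y := by
  let h := κ.schemeIsoToHomeo
  let e : Y ≃o Y' := ⟨h.toEquiv, by
    intro a b
    exact h.isInducing.specializes_iff⟩
  exact Order.height_orderIso e y

end AlgebraicGeometry

section

variable {Y Y' : Scheme.{u}} (κ : Y ≅ Y')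

/-- An isomorphism preserves heights and has residue degree one, so the weight condition and the
degree factor in `AlgebraicCycle.map` have no effect. -/
theorem cyclePushforward_apply (c : AlgebraicCycle Y ℤ) (y : Y) :
    cyclePushforward κ c (κ.hom y) = c y := by
  have h : κ.hom ⁻¹' {κ.hom y} = {y} := by
    ext z
    exact κ.schemeIsoToHomeo.injective.eq_iff
  rw [cyclePushforward, AlgebraicCycle.map, Function.locallyFinsupp.map_apply, h,
    finsum_mem_singleton, AlgebraicCycle.mapCoeff, if_pos (Scheme.height_apply_of_iso κ y).symm,
    Scheme.Hom.residueDegree_eq_one_of_isIso]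
  simp

theorem algebraicCycle_ext_of_iso {c d : AlgebraicCycle Y' ℤ}
    (h : ∀ y, c (κ.hom y) = d (κ.hom y)) : c = d := by
  ext z
  obtain ⟨y, rfl⟩ := κ.schemeIsoToHomeo.surjective z
  exact h y

theorem cyclePushforward_inv_hom (c : AlgebraicCycle Y ℤ) :
    cyclePushforward κ.symm (cyclePushforward κ c) = c := by
  refine algebraicCycle_ext_of_iso κ.symm fun z => ?_
  rw [cyclePushforward_apply]
  obtain ⟨y, rfl⟩ := κ.schemeIsoToHomeo.surjective z
  change cyclePushforward κ c (κ.hom y) = c (κ.inv (κ.hom y))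
  rw [cyclePushforward_apply]
  simp

/-- Push-forward of cycles along an isomorphism, as a homomorphism of groups. -/
noncomputable def cyclePushforwardHom : AlgebraicCycle Y ℤ →+ AlgebraicCycle Y' ℤ :=
  AddMonoidHom.mk' (cyclePushforward κ) fun c d => algebraicCycle_ext_of_iso κ fun y => by
    simp [cyclePushforward_apply]

/-- A generator goes to a generator with the same `W` and `r`: only the closed immersion is composed
with `κ`. -/
theorem cyclePushforward_mem_ratTrivialCycles {c : AlgebraicCycle Y ℤ}
    (hc : c ∈ ratTrivialCycles Y) : cyclePushforward κ c ∈ ratTrivialCycles Y' := by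
  suffices h : ratTrivialCycles Y ≤ (ratTrivialCycles Y').comap (cyclePushforwardHom κ) from h hc
  refine (AddSubgroup.closure_le _).2 ?_
  rintro c ⟨W, i, _, _, _, r, hr, hdiv⟩
  refine AddSubgroup.subset_closure
    ⟨W, i ≫ κ.hom, inferInstance, inferInstance, inferInstance, r, hr, fun w => ?_, fun z hz => ?_⟩
  · rw [Scheme.Hom.comp_apply]
    exact (cyclePushforward_apply κ c _).trans (hdiv.1 w)
  · obtain ⟨y, rfl⟩ := κ.schemeIsoToHomeo.surjective z
    refine (cyclePushforward_apply κ c _).trans (hdiv.2 y ?_)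
    rintro ⟨w, rfl⟩
    exact hz ⟨w, Scheme.Hom.comp_apply _ _ _⟩

theorem ratEquiv_cyclePushforward_iff (α β : AlgebraicCycle Y ℤ) :
    RatEquiv α β ↔ RatEquiv (cyclePushforward κ α) (cyclePushforward κ β) := by
  have hsub : cyclePushforward κ α - cyclePushforward κ β = cyclePushforward κ (α - β) :=
    ((cyclePushforwardHom κ).map_sub α β).symm
  rw [RatEquiv, RatEquiv, hsub]
  refine ⟨cyclePushforward_mem_ratTrivialCycles κ, fun h => ?_⟩
  have := cyclePushforward_mem_ratTrivialCycles κ.symm h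
  rwa [cyclePushforward_inv_hom] at this

end

/-! ### Points of the base, comparison of fibers, and the theorem -/

/-- There is at most one ring homomorphism out of `ZMod p`, so compatibility with the structure
morphisms to the prime field is automatic. -/
theorem specPrimeField_hom_ext {p : ℕ} {Y : Scheme.{u}} (a b : Y ⟶ Spec (PrimeFieldRing.{u} p)) :
    a = b := by
  refine (cancel_mono (Scheme.toSpecΓ _)).1 ?_
  rw [Scheme.toSpecΓ_naturality, Scheme.toSpecΓ_naturality]
  have h (x y : PrimeFieldRing.{u} p ⟶ Γ(Y, ⊤)) : x = y := by
    ext z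
    have := Subsingleton.elim (x.hom.comp (ULift.ringEquiv : ULift.{u} (ZMod p) ≃+* _).symm.toRingHom)
      (y.hom.comp (ULift.ringEquiv : ULift.{u} (ZMod p) ≃+* _).symm.toRingHom)
    exact congr($this z.down)
  have : a.appTop = b.appTop := by
    rw [← cancel_epi (Scheme.ΓSpecIso _).inv]
    exact h _ _
  rw [this]

theorem isCOpen_iInter {T I : Type*} [TopologicalSpace T] [Countable I] [Nonempty I]
    (U : I → TopologicalSpace.Opens T) : IsCOpen (⋂ i, (U i : Set T)) := by
  obtain ⟨e, he⟩ := exists_surjective_nat I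
  refine ⟨fun n => (U (e n) : Set T)ᶜ, fun n => (U (e n)).2.isClosed_compl, ?_⟩
  rw [Set.compl_iInter, he.iUnion_comp fun i => (U i : Set T)ᶜ]

namespace AlgebraicGeometry

variable {T : Scheme.{u}}

theorem range_fromGeomGenericPoint [IsIntegral T] (y : geomGenericPoint T) :
    fromGeomGenericPoint T y = genericPoint T := by
  have h (z : Spec T.functionField) : T.fromSpecStalk (genericPoint T) z = genericPoint T := by
    rw [Subsingleton.elim (α := PrimeSpectrum T.functionField) z
      (IsLocalRing.closedPoint T.functionField)]
    exact Scheme.fromSpecStalk_closedPoint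
  exact h _

/-- The homomorphism to a field `K` given by evaluating functions at a `K`-valued point. -/
noncomputable def evalAtPoint {S : Scheme.{u}} {K : Type u} [Field K]
    (x : Spec (CommRingCat.of K) ⟶ S) : Γ(S, ⊤) →+* K :=
  (x.appTop ≫ (Scheme.ΓSpecIso (CommRingCat.of K)).hom).hom

theorem evalAtPoint_ne_zero {S : Scheme.{u}} {K : Type u} [Field K]
    (x : Spec (CommRingCat.of K) ⟶ S) {a : Γ(S, ⊤)} {t : S} (hx : ∀ y, x y = t)
    (h : t ∈ S.basicOpen a) : evalAtPoint x a ≠ 0 := by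
  intro h0
  refine appTop_ne_zero_of_mem_basicOpen x a (IsLocalRing.closedPoint K) ((hx _).symm ▸ h) ?_
  exact (Scheme.ΓSpecIso (CommRingCat.of K)).commRingCatIsoToRingEquiv.injective
    (h0.trans (map_zero _).symm)

theorem evalAtPoint_comp_SpecMap {S : Scheme.{u}} {K L : Type u} [Field K] [Field L]
    (x : Spec (CommRingCat.of K) ⟶ S) (e : K →+* L) (a : Γ(S, ⊤)) :
    evalAtPoint (Spec.map (CommRingCat.ofHom e) ≫ x) a = e (evalAtPoint x a) := by
  have := Scheme.ΓSpecIso_naturality (CommRingCat.ofHom e)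
  have h2 : (Spec.map (CommRingCat.ofHom e) ≫ x).appTop ≫ (Scheme.ΓSpecIso _).hom =
      (x.appTop ≫ (Scheme.ΓSpecIso _).hom) ≫ CommRingCat.ofHom e := by
    rw [Scheme.Hom.comp_appTop, Category.assoc, this, Category.assoc]
  exact congr(($h2).hom a)

theorem appTop_eq_of_evalAtPoint_eq {S : Scheme.{u}} {K : Type u} [Field K]
    {x x' : Spec (CommRingCat.of K) ⟶ S} {a : Γ(S, ⊤)} (h : evalAtPoint x a = evalAtPoint x' a) :
    x.appTop a = x'.appTop a :=
  (Scheme.ΓSpecIso (CommRingCat.of K)).commRingCatIsoToRingEquiv.injective h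

/-- A point of an integral affine scheme outside the zero loci of all nonzero elements of a
countable ring `A` of functions yields the same homomorphism out of `A` as the geometric generic
point, up to an isomorphism of residue fields. -/
theorem exists_ringEquiv_evalAtPoint {S : Scheme.{u}} (A : Subring Γ(S, ⊤)) [Countable A]
    {K L : Type u} [Field K] [Field L] [IsAlgClosed K] [IsAlgClosed L]
    (hK : Cardinal.aleph0 < Cardinal.mk K) (hKL : Cardinal.mk K = Cardinal.mk L)
    (x : Spec (CommRingCat.of K) ⟶ S) (x' : Spec (CommRingCat.of L) ⟶ S) {t t' : S}
    (hx : ∀ y, x y = t) (hx' : ∀ y, x' y = t') (ht : ∀ a ∈ A, a ≠ 0 → t ∈ S.basicOpen a)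
    (ht' : ∀ a ∈ A, a ≠ 0 → t' ∈ S.basicOpen a) :
    ∃ e : K ≃+* L, ∀ a ∈ A, e (evalAtPoint x a) = evalAtPoint x' a := by
  have inj {K : Type u} [Field K] (x : Spec (CommRingCat.of K) ⟶ S) {t : S} (hx : ∀ y, x y = t)
      (ht : ∀ a ∈ A, a ≠ 0 → t ∈ S.basicOpen a) :
      Function.Injective ((evalAtPoint x).comp A.subtype) := by
    rw [injective_iff_map_eq_zero]
    intro a ha
    by_contra h0
    exact evalAtPoint_ne_zero x hx (ht a a.2 fun h => h0 (Subtype.ext h)) ha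
  obtain ⟨e, he⟩ := IsAlgClosed.exists_ringEquiv_comp_eq hK hKL _ _ (inj x hx ht) (inj x' hx' ht')
  exact ⟨e, fun a ha => he ⟨a, ha⟩⟩

/-- Let `f : X ⟶ T` be such that its restriction `g` over an open immersion `j : S ⟶ T` satisfies
the conclusion of `exists_countable_isoOfIsPullback`. Then two field-valued points of `S` that agree
on `s` up to an isomorphism of fields have isomorphic fibers. -/
theorem exists_iso_of_evalAtPoint {X S : Scheme.{u}} {f : X ⟶ T} {j : S ⟶ T} {s : Set Γ(S, ⊤)}
    (H : ∀ (P P' K : Scheme.{u}) (x x' : K ⟶ S) (a : P ⟶ pullback f j)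
      (b : P ⟶ K) (a' : P' ⟶ pullback f j) (b' : P' ⟶ K), IsPullback a b (pullback.snd f j) x →
      IsPullback a' b' (pullback.snd f j) x' →
      (∀ r ∈ s, x.appTop r = x'.appTop r) → ∃ m : P ≅ P', m.hom ≫ b' = b)
    {K L : Type u} [Field K] [Field L]
    (x : Spec (CommRingCat.of K) ⟶ S) (x' : Spec (CommRingCat.of L) ⟶ S) (e : K ≃+* L)
    (he : ∀ a ∈ s, e (evalAtPoint x a) = evalAtPoint x' a)
    {P P' : Scheme.{u}} {a : P ⟶ X} {b : P ⟶ Spec (CommRingCat.of K)} {a' : P' ⟶ X}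
    {b' : P' ⟶ Spec (CommRingCat.of L)} (hP : IsPullback a b f (x ≫ j))
    (hP' : IsPullback a' b' f (x' ≫ j)) :
    ∃ m : P ≅ P', m.hom ≫ b' = b ≫ Spec.map (CommRingCat.ofHom e.symm.toRingHom) := by
  let E : Spec (CommRingCat.of K) ≅ Spec (CommRingCat.of L) :=
    Scheme.Spec.mapIso e.symm.toCommRingCatIso.op
  have h1 := hP.of_right' (IsPullback.of_hasPullback f j)
  have h2 := hP'.of_right' (IsPullback.of_hasPullback f j)
  -- Moves the first fiber to a square over `Spec L`, since `H` compares base changes along two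
  -- morphisms from the same source.
  have h3 := h1.paste_vert (IsPullback.of_vert_isIso (snd := E.hom) (g := E.inv ≫ x) (fst := x)
    (f := 𝟙 S) ⟨by simp⟩)
  rw [Category.comp_id] at h3
  refine H P P' _ _ _ _ _ _ _ h3 h2 fun r hr => appTop_eq_of_evalAtPoint_eq ?_
  rw [← he r hr]
  exact evalAtPoint_comp_SpecMap x e.toRingHom r

theorem Scheme.isAlgClosed_residueField {k : Type u} [Field k] [IsAlgClosed k]
    (s : T ⟶ Spec (CommRingCat.of k)) [LocallyOfFiniteType s] {t : T} (ht : IsClosed ({t} : Set T)) :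
    IsAlgClosed (T.residueField t) :=
  IsAlgClosed.of_ringEquiv k _ (residueFieldIsoBase s t ht).commRingCatIsoToRingEquiv.symm

theorem Scheme.cardinalMk_residueField {k : Type u} [Field k] [IsAlgClosed k]
    (s : T ⟶ Spec (CommRingCat.of k)) [LocallyOfFiniteType s] {t : T} (ht : IsClosed ({t} : Set T)) :
    Cardinal.mk (T.residueField t) = Cardinal.mk k :=
  Cardinal.mk_congr (residueFieldIsoBase s t ht).commRingCatIsoToRingEquiv.toEquiv

end AlgebraicGeometry

theorem mainTheorem4
    (p : ℕ) [Fact p.Prime] (k : Type u) [Field k] [IsAlgClosed k] [Uncountable k] [CharP k p]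
    (T : Scheme.{u}) [IsIntegral T] (s : T ⟶ Spec (CommRingCat.of k))
    [LocallyOfFiniteType s] [QuasiCompact s]
    (ι : Type v) [Countable ι] (X : ι → Scheme.{u}) (f : ∀ i, X i ⟶ T)
    [∀ i, Flat (f i)] [∀ i, LocallyOfFiniteType (f i)] [∀ i, QuasiCompact (f i)] :
    ∃ U₀ : Set T, IsCOpen U₀ ∧ genericPoint T ∈ U₀ ∧
      ∀ t ∈ U₀, IsClosed ({t} : Set T) →
        -- the isomorphism of points over the prime field
        ∃ e : Spec (T.residueField t) ≅ geomGenericPoint T,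
          e.hom ≫ fromGeomGenericPoint T ≫ s ≫ specToPrimeField p k =
            T.fromSpecResidueField t ≫ s ≫ specToPrimeField p k ∧
          -- the induced isomorphisms of fibers
          ∀ i, ∃ κ : (f i).fiber t ≅ geomGenericFiber (f i),
            IsPullback κ.hom ((f i).fiberToSpecResidueField t)
              (geomGenericFiberToPoint (f i)) e.hom ∧
            κ.hom ≫ geomGenericFiberι (f i) ≫ f i ≫ s ≫ specToPrimeField p k =
              (f i).fiberι t ≫ f i ≫ s ≫ specToPrimeField p k ∧
            ∀ α β : AlgebraicCycle ((f i).fiber t) ℤ,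
              RatEquiv α β ↔ RatEquiv (cyclePushforward κ α) (cyclePushforward κ β) := by
  obtain ⟨U, hU, hη, -⟩ := exists_isAffineOpen_mem_and_subset (x := genericPoint T) (U := ⊤) trivial
  have : IsAffine U := hU
  have : Nonempty U := ⟨⟨_, hη⟩⟩
  -- Noetherianity turns finite type into finite presentation and makes the total spaces over `U`
  -- quasi-separated.
  have : IsLocallyNoetherian T := LocallyOfFiniteType.isLocallyNoetherian s
  have hcompact (i) : CompactSpace ↥(pullback (f i) U.ι) :=
    QuasiCompact.compactSpace_of_compactSpace (pullback.snd (f i) U.ι)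
  have hqs (i) : QuasiSeparatedSpace ↥(pullback (f i) U.ι) :=
    have := LocallyOfFiniteType.isLocallyNoetherian (pullback.snd (f i) U.ι)
    inferInstance
  choose S hS H using fun i => exists_countable_isoOfIsPullback (pullback.snd (f i) U.ι)
  let A : Subring Γ(U, ⊤) := Subring.closure (⋃ i, S i)
  have : Countable A := (Set.countable_iUnion hS).subringClosure
  let J := {a : A // a ≠ 0}
  -- The element `1` has all of `U` as its basic open, which forces `U₀` into `U`.
  have : Nonempty J := ⟨1, one_ne_zero⟩
  have hgen (a : J) : genericPoint T ∈ U.ι ''ᵁ U.toScheme.basicOpen a.1.1 := by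
    -- On an integral scheme a nonzero function has nonempty nonvanishing locus, and a nonempty open
    -- contains the generic point.
    have hne : U.toScheme.basicOpen a.1.1 ≠ ⊥ := fun h =>
      a.2 (Subtype.ext ((basicOpen_eq_bot_iff _).1 h))
    obtain ⟨y, hy⟩ := (TopologicalSpace.Opens.ne_bot_iff_nonempty _).1 hne
    exact ((genericPoint_spec T).mem_open_set_iff (U.ι ''ᵁ U.toScheme.basicOpen a.1.1).2).2
      ⟨U.ι y, trivial, y, hy, rfl⟩
  refine ⟨⋂ a : J, (U.ι ''ᵁ U.toScheme.basicOpen a.1.1 : T.Opens), isCOpen_iInter _,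
    Set.mem_iInter.2 hgen, fun t ht htc => ?_⟩
  have hbasic {t : T} (ht : ∀ a : J, t ∈ U.ι ''ᵁ U.toScheme.basicOpen a.1.1) :
      ∃ t' : U, U.ι t' = t ∧ ∀ a ∈ A, a ≠ 0 → t' ∈ U.toScheme.basicOpen a := by
    obtain ⟨t', -, h⟩ := ht ⟨1, one_ne_zero⟩
    refine ⟨t', h, fun a ha h0 => ?_⟩
    obtain ⟨t'', h1, h2⟩ := ht ⟨⟨a, ha⟩, fun h => h0 congr(($h).1)⟩
    rwa [← U.ι.injective (h.trans h2.symm)] at h1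
  obtain ⟨t', rfl, ht'⟩ := hbasic fun a => Set.mem_iInter.1 ht a
  obtain ⟨η', hη', hη''⟩ := hbasic hgen
  have hlift {K : Scheme.{u}} (x : K ⟶ T) {t : U} (h : ∀ y, x y = U.ι t) :
      ∃ x' : K ⟶ U.toScheme, x' ≫ U.ι = x ∧ ∀ y, x' y = t := by
    have hr : Set.range x ⊆ Set.range U.ι := by
      rintro _ ⟨y, rfl⟩
      exact ⟨t, (h y).symm⟩
    refine ⟨IsOpenImmersion.lift U.ι x hr, IsOpenImmersion.lift_fac _ _ _, fun y => ?_⟩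
    refine U.ι.injective ?_
    rw [← Scheme.Hom.comp_apply, IsOpenImmersion.lift_fac, h]
  obtain ⟨x, hx, hxt⟩ := hlift (T.fromSpecResidueField (U.ι t')) (t := t') fun y =>
    Scheme.fromSpecResidueField_apply _ _
  obtain ⟨x', hx', hxη⟩ := hlift (fromGeomGenericPoint T) (t := η') fun y => by
    rw [hη']; exact range_fromGeomGenericPoint y
  have hcard := Scheme.cardinalMk_residueField s htc
  have := Scheme.isAlgClosed_residueField s htc
  have huncount : Cardinal.aleph0 < Cardinal.mk k := Cardinal.aleph0_lt_mk_iff.2 ‹_›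
  obtain ⟨e, he⟩ := exists_ringEquiv_evalAtPoint A (K := T.residueField (U.ι t'))
    (L := AlgebraicClosure T.functionField) (hcard ▸ huncount)
    (hcard.trans (Scheme.cardinalMk_geomGenericPoint s).symm) x x' hxt hxη ht' hη''
  let E : Spec (T.residueField (U.ι t')) ≅ geomGenericPoint T :=
    Scheme.Spec.mapIso e.symm.toCommRingCatIso.op
  refine ⟨E, by simpa only [Category.assoc] using specPrimeField_hom_ext _ _, fun i => ?_⟩
  have hP : IsPullback ((f i).fiberι (U.ι t')) ((f i).fiberToSpecResidueField (U.ι t')) (f i)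
      (x ≫ U.ι) := hx ▸ IsPullback.of_hasPullback _ _
  have hP' : IsPullback (geomGenericFiberι (f i)) (geomGenericFiberToPoint (f i)) (f i)
      (x' ≫ U.ι) := hx' ▸ IsPullback.of_hasPullback _ _
  obtain ⟨m, hm⟩ := exists_iso_of_evalAtPoint (H i) x x' e
    (fun a ha => he a (Subring.subset_closure (Set.mem_iUnion.2 ⟨i, ha⟩))) hP hP'
  exact ⟨m, IsPullback.of_horiz_isIso ⟨hm⟩, specPrimeField_hom_ext _ _,
    ratEquiv_cyclePushforward_iff m⟩
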